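/- Let $\Sigma$ be a finite alphabet and let $P$ be a probability distribution on $\Sigma^n$, $n\ge 1$, the joint law of variables indexed by $V=\{1,\dots,n\}$. Suppose that $P$ is Markov with respect to a polytree $G^*$ on $V$: $G^*$ is a directed acyclic graph whose skeleton $\mathrm{skel}(G^*)$ (the underlying undirected graph) is a forest, and $P(x)=\prod_{v}P(x_v\mid x_{\pi(v)})$, where $\pi(v)$ is the set of parents of $v$ in $G^*$. Write $I(u;v)$ for the mutual information of the variables $u$ and $v$ under $P$. Suppose that $\varepsilon_P>0$ satisfies the gap assumption: 1. if $u$ and $v$ are joined in $\mathrm{skel}(G^*)$ by a path with at least two edges (equivalently, visiting more than two vertices), then $I(u;v)+\varepsilon_P\le I(a;b)$ for every edge $a-b$ of this path; 2. $I(a;b)\ge\varepsilon_P$ for every edge $a-b$ of $\mathrm{skel}(G^*)$. Let $\hat I(u;v)$ be the mutual information of $u$ and $v$ under the empirical distribution of $m$ i.i.d. samples from $P$. The Chow–Liu algorithm outputs a maximum-weight spanning tree $T$ of the complete graph on $V$ with edge weights $\hat I(u;v)$, ties being broken arbitrarily. **Lemma.** For every $c>0$ there is a constant $C>0$, depending only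 on $c$ and $|\Sigma|$, such that whenever $m\ge C\,\dfrac{\log n}{\varepsilon_P^2}$, with probability at least $1-n^{-c}$ every possible output $T$ of the Chow–Liu algorithm recovers a ground truth skeleton, in the following sense: - $T$ is the skeleton of a polytree with respect to which $P$ is Markov; - $T$ contains every edge of $\mathrm{skel}(G^*)$, and every other edge of $T$ joins two different connected components of $\mathrm{skel}(G^*)$ and has strictly smaller weight $\hat I$ than every edge of $\mathrm{skel}(G^*)$; - in particular, $T=\mathrm{skel}(G^*)$ if $\mathrm{skel}(G^*)$ is connected. -/

import Mathlib

open MeasureTheory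

noncomputable section

namespace ChowLiu

variable {V A : Type*} [Fintype V] [DecidableEq V] [Fintype A] [DecidableEq A]

/-! ### Mass functions, marginals, mutual information -/

/-- The marginal mass that `p` puts on the event that the variables in `s` take the values
that they have in `x`. -/
def marginal (p : (V → A) → ℝ) (s : Finset V) (x : V → A) : ℝ :=
  ∑ y with ∀ v ∈ s, y v = x v, p y

/-- The marginal `p(X_u = a)`. -/
def marginalOne (p : (V → A) → ℝ) (u : V) (a : A) : ℝ :=
  ∑ y with y u = a, p y

/-- The joint marginal `p(X_u = a, X_v = b)`. -/
def marginalTwo (p : (V → A) → ℝ) (u v : V) (a b : A) : ℝ :=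
  ∑ y with y u = a ∧ y v = b, p y

/-- The mutual information `I(u;v)` of the variables `u` and `v` under `p`, in nats.
Terms with `p(a,b) = 0` vanish, the usual convention. -/
def mutualInfo (p : (V → A) → ℝ) (u v : V) : ℝ :=
  ∑ a, ∑ b, marginalTwo p u v a b *
    Real.log (marginalTwo p u v a b / (marginalOne p u a * marginalOne p v b))

theorem mutualInfo_comm (p : (V → A) → ℝ) (u v : V) : mutualInfo p u v = mutualInfo p v u := by
  have h : ∀ a b, marginalTwo p u v a b = marginalTwo p v u b a := by
    intro a b
    simp only [marginalTwo, and_comm]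
  simp only [mutualInfo, h]
  rw [Finset.sum_comm]
  simp only [mul_comm (marginalOne p u _)]

/-- The real-valued mass function of a `PMF`. -/
def massFunction (P : PMF (V → A)) (x : V → A) : ℝ := (P x).toReal

/-- The empirical mass function of a sample of size `m`. -/
def empirical {m : ℕ} (S : Fin m → V → A) (x : V → A) : ℝ :=
  ((Finset.univ.filter fun i => S i = x).card : ℝ) / m

/-! ### Polytrees and Bayesian networks -/

/-- The skeleton of a directed graph: forget the orientations. -/
def skel (G : Digraph V) : SimpleGraph V := G.toSimpleGraphInclusive

/-- A polytree is a directed acyclic graph whose skeleton is a forest. -/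
def IsPolytree (G : Digraph V) : Prop :=
  (∀ v, ¬ Relation.TransGen G.Adj v v) ∧ (skel G).IsAcyclic

open Classical in
/-- The set `π_G(v)` of parents of `v`. -/
def parents (G : Digraph V) (v : V) : Finset V := Finset.univ.filter fun u => G.Adj u v

/-- `P` is defined on (Markov with respect to) `G`: `P(x) = ∏_v P(x_v ∣ x_{π(v)})`.
If some `P(x_{π(v)})` vanishes, then both sides are `0`. -/
def IsMarkov (P : PMF (V → A)) (G : Digraph V) : Prop :=
  ∀ x, massFunction P x =
    ∏ v, marginal (massFunction P) (insert v (parents G v)) x /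
      marginal (massFunction P) (parents G v) x

/-- The gap assumption with gap `ε`. A path with at least two edges is one that visits more than
two vertices. -/
def GapAssumption (P : PMF (V → A)) (G : Digraph V) (ε : ℝ) : Prop :=
  (∀ (u v : V) (w : (skel G).Walk u v), w.IsPath → 2 ≤ w.length →
    ∀ a b, s(a, b) ∈ w.edges →
      mutualInfo (massFunction P) u v + ε ≤ mutualInfo (massFunction P) a b) ∧
  (∀ a b, (skel G).Adj a b → ε ≤ mutualInfo (massFunction P) a b)

/-! ### The Chow–Liu algorithm -/

open Classical in
/-- Total weight of the edges of `T`, an edge `uv` having weight `I_p(u;v)`. -/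
def totalWeight (p : (V → A) → ℝ) (T : SimpleGraph V) : ℝ :=
  ∑ e ∈ T.edgeFinset, Sym2.lift ⟨mutualInfo p, mutualInfo_comm p⟩ e

/-- `T` is a possible output of the Chow–Liu algorithm on `p`: a spanning tree of the complete
graph on `V` of maximum total weight. -/
def IsChowLiuTree (p : (V → A) → ℝ) (T : SimpleGraph V) : Prop :=
  T.IsTree ∧ ∀ T' : SimpleGraph V, T'.IsTree → totalWeight p T' ≤ totalWeight p T

/-- The law of `m` independent samples from `P`. -/
def sampleLaw [MeasurableSpace A] (P : PMF (V → A)) (m : ℕ) : Measure (Fin m → V → A) :=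
  Measure.pi fun _ => P.toMeasure

end ChowLiu

end

/-! It suffices that every empirical mutual information is within `ε / 2` of the true one; the rest
is deterministic. Accuracy: mutual information is a signed sum of terms `-x log x`, whose slope is
unbounded at `0`, but which are 4-Lipschitz in `√x` on `[0, 1]`. The square root of an empirical
frequency has tail `2 exp(-m δ²)` whatever the true probability (`sampleLaw_sqrt_deviation`). So `δ`
of order `ε` and a union bound over pairs of variables and values give `m` of order `log n / ε²`,
with no further logarithm of `1 / ε`. Recovery: if a skeleton edge `ab` is missing from `T`,
deleting it from the forest creates a cut, which some edge `xy` of `T` crosses. The skeleton path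
from `x` to `y`, if any, uses `ab`; otherwise `x` and `y` are independent. In both cases `I(x;y) + ε
≤ I(a;b)`, so swapping the edges would increase the weight (`IsChowLiuTree.skel_le`). The other
edges of `T` join different components, because `T` is acyclic. Oriented along a linear order
extending that of `G`, they keep the graph acyclic, and independence of components keeps `P` Markov
(`IsMarkov.of_le`). -/

namespace ChowLiu

/-! ### Stability of mutual information -/

/-- With `z = √x` the function becomes `-2 z² log z`, whose derivative `-4 z log z - 2 z` stays
between `-4` and `4` on `(0, 1)`. -/
theorem abs_negMulLog_sub_le {x y : ℝ} (hx₀ : 0 ≤ x) (hx₁ : x ≤ 1) (hy₀ : 0 ≤ y) (hy₁ : y ≤ 1) :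
    |Real.negMulLog x - Real.negMulLog y| ≤ 4 * |√x - √y| := by
  wlog h : y ≤ x generalizing x y
  · rw [abs_sub_comm, abs_sub_comm (√x)]
    exact this hy₀ hy₁ hx₀ hx₁ (le_of_not_ge h)
  have key : ∀ z : ℝ, 0 ≤ z → Real.negMulLog z = 2 * √z * Real.negMulLog (√z) := by
    intro z hz
    have h1 : Real.log (√z) = Real.log z / 2 := Real.log_sqrt hz
    have h2 := Real.mul_self_sqrt hz
    simp only [Real.negMulLog, h1]
    linear_combination -(Real.log z) * h2.symm
  rw [key x hx₀, key y hy₀]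
  have hs : √y ≤ √x := Real.sqrt_le_sqrt h
  rw [abs_of_nonneg (sub_nonneg.2 hs)]
  have hder : ∀ z ∈ interior (Set.Icc (0 : ℝ) 1),
      HasDerivAt (fun z => 2 * z * Real.negMulLog z) (4 * Real.negMulLog z - 2 * z) z := by
    intro z hz
    rw [interior_Icc] at hz
    have h1 := ((hasDerivAt_id z).const_mul 2).mul (Real.hasDerivAt_negMulLog hz.1.ne')
    refine h1.congr_deriv ?_
    simp only [id, Real.negMulLog]
    ring
  have hcont : ContinuousOn (fun z => 2 * z * Real.negMulLog z) (Set.Icc (0 : ℝ) 1) :=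
    ((continuous_const.mul continuous_id).mul Real.continuous_negMulLog).continuousOn
  have hdiff : DifferentiableOn ℝ (fun z => 2 * z * Real.negMulLog z)
      (interior (Set.Icc (0 : ℝ) 1)) := fun z hz =>
    (hder z hz).differentiableAt.differentiableWithinAt
  have hxm : √x ∈ Set.Icc (0 : ℝ) 1 := ⟨Real.sqrt_nonneg _, Real.sqrt_le_one.2 hx₁⟩
  have hym : √y ∈ Set.Icc (0 : ℝ) 1 := ⟨Real.sqrt_nonneg _, Real.sqrt_le_one.2 hy₁⟩
  have hup := (convex_Icc (0 : ℝ) 1).image_sub_le_mul_sub_of_deriv_le hcont hdiff (C := 4)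
    (fun z hz => by
      rw [(hder z hz).deriv]
      rw [interior_Icc] at hz
      have h1 := Real.one_sub_inv_le_log_of_pos hz.1
      have h2 : z * (1 - z⁻¹) ≤ z * Real.log z := mul_le_mul_of_nonneg_left h1 hz.1.le
      rw [mul_sub, mul_inv_cancel₀ hz.1.ne'] at h2
      simp only [Real.negMulLog]
      linarith [hz.1]) _ hym _ hxm hs
  have hlo := (convex_Icc (0 : ℝ) 1).mul_sub_le_image_sub_of_le_deriv hcont hdiff (C := -4)
    (fun z hz => by
      rw [(hder z hz).deriv]
      rw [interior_Icc] at hz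
      have := Real.negMulLog_nonneg hz.1.le hz.2.le
      linarith [hz.2]) _ hym _ hxm hs
  rw [abs_le]
  constructor <;> linarith

section Entropy

variable {V A : Type*} [Fintype V] [DecidableEq V] [Fintype A] [DecidableEq A]

theorem marginalTwo_self (p : (V → A) → ℝ) (u : V) (a : A) :
    marginalTwo p u u a a = marginalOne p u a := by
  simp only [marginalTwo, marginalOne, and_self]

theorem sum_marginalTwo_right (p : (V → A) → ℝ) (u v : V) (a : A) :
    ∑ b, marginalTwo p u v a b = marginalOne p u a := by
  simp only [marginalTwo, marginalOne]
  rw [← Finset.sum_fiberwise (Finset.univ.filter fun y : V → A => y u = a) (fun y => y v)]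
  simp only [Finset.filter_filter]

theorem sum_marginalTwo_left (p : (V → A) → ℝ) (u v : V) (b : A) :
    ∑ a, marginalTwo p u v a b = marginalOne p v b := by
  rw [← sum_marginalTwo_right p v u b]
  simp only [marginalTwo, and_comm]

theorem marginalTwo_nonneg {p : (V → A) → ℝ} (hp : ∀ x, 0 ≤ p x) (u v : V) (a b : A) :
    0 ≤ marginalTwo p u v a b := Finset.sum_nonneg fun x _ => hp x

theorem marginalTwo_le_one {p : (V → A) → ℝ} (hp : ∀ x, 0 ≤ p x) (h1 : ∑ x, p x ≤ 1)
    (u v : V) (a b : A) : marginalTwo p u v a b ≤ 1 :=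
  (Finset.sum_le_sum_of_subset_of_nonneg (Finset.filter_subset _ _) fun x _ _ => hp x).trans h1

/-- The single-variable entropies are written with the diagonal cells of `marginalTwo p u u`, so
that one estimate on two-variable marginals controls all three terms. -/
theorem mutualInfo_eq_entropy {p : (V → A) → ℝ} (hp : ∀ x, 0 ≤ p x) (u v : V) :
    mutualInfo p u v = ∑ a, Real.negMulLog (marginalTwo p u u a a) +
      ∑ b, Real.negMulLog (marginalTwo p v v b b) -
      ∑ a, ∑ b, Real.negMulLog (marginalTwo p u v a b) := by
  have hterm : ∀ a b, marginalTwo p u v a b *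
      Real.log (marginalTwo p u v a b / (marginalOne p u a * marginalOne p v b)) =
      -(marginalTwo p u v a b * Real.log (marginalOne p u a)) -
      marginalTwo p u v a b * Real.log (marginalOne p v b) -
      Real.negMulLog (marginalTwo p u v a b) := by
    intro a b
    rcases (marginalTwo_nonneg hp u v a b).eq_or_lt with h | h
    · simp [← h]
    · have hu : 0 < marginalOne p u a := by
        rw [← sum_marginalTwo_right p u v a]
        exact h.trans_le (Finset.single_le_sum (fun b _ => marginalTwo_nonneg hp u v a b)
          (Finset.mem_univ b))
      have hv : 0 < marginalOne p v b := by
        rw [← sum_marginalTwo_left p u v b]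
        exact h.trans_le (Finset.single_le_sum (fun a _ => marginalTwo_nonneg hp u v a b)
          (Finset.mem_univ a))
      rw [Real.log_div h.ne' (mul_pos hu hv).ne', Real.log_mul hu.ne' hv.ne', Real.negMulLog]
      ring
  simp only [mutualInfo, hterm, Finset.sum_sub_distrib, marginalTwo_self]
  congr 1
  have h1 : ∑ a, ∑ b, -(marginalTwo p u v a b * Real.log (marginalOne p u a)) =
      ∑ a, Real.negMulLog (marginalOne p u a) := by
    refine Finset.sum_congr rfl fun a _ => ?_
    rw [Finset.sum_neg_distrib, ← Finset.sum_mul, sum_marginalTwo_right, Real.negMulLog, neg_mul]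
  have h2 : ∑ a, ∑ b, marginalTwo p u v a b * Real.log (marginalOne p v b) =
      -∑ b, Real.negMulLog (marginalOne p v b) := by
    rw [Finset.sum_comm, ← Finset.sum_neg_distrib]
    refine Finset.sum_congr rfl fun b _ => ?_
    rw [← Finset.sum_mul, sum_marginalTwo_left, Real.negMulLog, neg_mul, neg_neg]
  rw [h1, h2]
  ring

/-- Mutual information is Lipschitz in the square roots of the two-variable marginals. -/
theorem abs_mutualInfo_sub_le {p q : (V → A) → ℝ} (hp : ∀ x, 0 ≤ p x) (hp₁ : ∑ x, p x ≤ 1)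
    (hq : ∀ x, 0 ≤ q x) (hq₁ : ∑ x, q x ≤ 1) {δ : ℝ}
    (h : ∀ u v a b, |√(marginalTwo p u v a b) - √(marginalTwo q u v a b)| ≤ δ) (u v : V) :
    |mutualInfo p u v - mutualInfo q u v| ≤
      4 * δ * (2 * Fintype.card A + (Fintype.card A : ℝ) ^ 2) := by
  have hcell : ∀ u v a b, |Real.negMulLog (marginalTwo p u v a b) -
      Real.negMulLog (marginalTwo q u v a b)| ≤ 4 * δ := fun u v a b =>
    (abs_negMulLog_sub_le (marginalTwo_nonneg hp u v a b) (marginalTwo_le_one hp hp₁ u v a b)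
      (marginalTwo_nonneg hq u v a b) (marginalTwo_le_one hq hq₁ u v a b)).trans
      (mul_le_mul_of_nonneg_left (h u v a b) (by norm_num))
  have hone : ∀ w, |∑ a, Real.negMulLog (marginalTwo p w w a a) -
      ∑ a, Real.negMulLog (marginalTwo q w w a a)| ≤ Fintype.card A * (4 * δ) := by
    intro w
    rw [← Finset.sum_sub_distrib]
    refine (Finset.abs_sum_le_sum_abs _ _).trans ?_
    refine (Finset.sum_le_card_nsmul _ _ _ fun a _ => hcell w w a a).trans ?_
    simp
  have htwo : |∑ a, ∑ b, Real.negMulLog (marginalTwo p u v a b) -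
      ∑ a, ∑ b, Real.negMulLog (marginalTwo q u v a b)| ≤
      Fintype.card A * (Fintype.card A * (4 * δ)) := by
    rw [← Finset.sum_sub_distrib]
    refine (Finset.abs_sum_le_sum_abs _ _).trans ?_
    refine (Finset.sum_le_card_nsmul _ _ (Fintype.card A * (4 * δ)) fun a _ => ?_).trans ?_
    · rw [← Finset.sum_sub_distrib]
      refine (Finset.abs_sum_le_sum_abs _ _).trans ?_
      refine (Finset.sum_le_card_nsmul _ _ _ fun b _ => hcell u v a b).trans ?_
      simp
    · simp
  rw [mutualInfo_eq_entropy hp, mutualInfo_eq_entropy hq]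
  have hu := abs_le.1 (hone u)
  have hv := abs_le.1 (hone v)
  have ht := abs_le.1 htwo
  rw [abs_le]
  constructor <;> nlinarith

end Entropy

end ChowLiu

namespace ChowLiu

/-! ### Concentration of empirical frequencies -/

section Concentration

variable {V A : Type*} [Fintype V] [DecidableEq V] [Fintype A] [DecidableEq A]

theorem massFunction_nonneg {V A : Type*} (P : PMF (V → A)) (x : V → A) : 0 ≤ massFunction P x :=
  ENNReal.toReal_nonneg

theorem sum_massFunction {V A : Type*} [Fintype V] [DecidableEq V] [Fintype A] (P : PMF (V → A)) : ∑ x, massFunction P x = 1 := by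
  simp only [massFunction]
  rw [← ENNReal.toReal_sum fun x _ => P.apply_ne_top x, ← tsum_fintype (L := .unconditional _),
    P.tsum_coe, ENNReal.toReal_one]

theorem empirical_nonneg {V A : Type*} [Fintype V] [DecidableEq A] {m : ℕ} (S : Fin m → V → A) (x : V → A) : 0 ≤ empirical S x := by
  unfold empirical
  positivity

theorem sum_empirical_filter {m : ℕ} (S : Fin m → V → A) (E : (V → A) → Prop)
    [DecidablePred E] :
    ∑ x with E x, empirical S x = (∑ i, if E (S i) then (1 : ℝ) else 0) / m := by
  have h : ∀ x, empirical S x = (∑ i, if S i = x then (1 : ℝ) else 0) / m := by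
    intro x
    rw [empirical, Finset.sum_boole]
  simp only [h]
  rw [← Finset.sum_div, Finset.sum_comm]
  congr 1
  refine Finset.sum_congr rfl fun i _ => ?_
  simp [Finset.sum_ite_eq]

theorem sum_empirical_le_one {m : ℕ} (S : Fin m → V → A) : ∑ x, empirical S x ≤ 1 := by
  have h := sum_empirical_filter S (fun _ => True)
  simp only [Finset.filter_true, if_true, Finset.sum_const, Finset.card_univ, Fintype.card_fin,
    nsmul_eq_mul, mul_one] at h
  rw [h]
  -- For `m = 0` the empirical mass is `0`, hence an inequality only.
  exact div_self_le_one _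

variable [MeasurableSpace A] [MeasurableSingletonClass A]

instance (P : PMF (V → A)) (m : ℕ) : IsProbabilityMeasure (sampleLaw P m) := by
  unfold sampleLaw
  infer_instance

/-- The moment generating function of the indicator of an event. -/
theorem integral_exp_mul_indicator {V A : Type*} [Fintype V] [DecidableEq V] [Fintype A]
    [MeasurableSpace A] [MeasurableSingletonClass A] (P : PMF (V → A)) (E : (V → A) → Prop) [DecidablePred E]
    (t : ℝ) : ∫ x, Real.exp (t * if E x then 1 else 0) ∂P.toMeasure =
      1 + (∑ x with E x, massFunction P x) * (Real.exp t - 1) := by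
  rw [PMF.integral_eq_sum]
  have h : ∀ x, (P x).toReal • Real.exp (t * if E x then 1 else 0) =
      massFunction P x + (if E x then massFunction P x else 0) * (Real.exp t - 1) := by
    intro x
    simp only [massFunction, smul_eq_mul]
    split_ifs <;> simp
    ring
  simp only [h]
  rw [Finset.sum_add_distrib, sum_massFunction, ← Finset.sum_mul, Finset.sum_filter]

/-- The Chernoff bound for the number of samples in an event, with the moment generating function
bounded by that of a Poisson variable. -/
theorem sampleLaw_chernoff (P : PMF (V → A)) (m : ℕ) (E : (V → A) → Prop) [DecidablePred E]
    (t q : ℝ) :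
    (sampleLaw P m).real {S | t * (m * q) ≤ t * ∑ i, if E (S i) then (1 : ℝ) else 0} ≤
      Real.exp (m * ((∑ x with E x, massFunction P x) * (Real.exp t - 1) - t * q)) := by
  -- Keeping `t` on both sides of the event serves both tails: `t ≥ 0` gives the upper one, `t ≤ 0`
  -- the lower one.
  set p := ∑ x with E x, massFunction P x
  have hint : ∫ S, Real.exp (t * ∑ i, if E (S i) then (1 : ℝ) else 0) ∂sampleLaw P m ≤
      Real.exp (m * (p * (Real.exp t - 1))) := by
    simp only [Finset.mul_sum, Real.exp_sum]
    rw [sampleLaw, integral_fintype_prod_eq_pow (fun x => Real.exp (t * if E x then (1 : ℝ) else 0)),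
      integral_exp_mul_indicator, Fintype.card_fin, Real.exp_nat_mul]
    have h0 : 0 ≤ 1 + p * (Real.exp t - 1) := by
      rw [← integral_exp_mul_indicator]
      exact integral_nonneg fun x => (Real.exp_pos _).le
    refine pow_le_pow_left₀ h0 ?_ _
    linarith [Real.add_one_le_exp (p * (Real.exp t - 1))]
  have hmarkov := mul_meas_ge_le_integral_of_nonneg (μ := sampleLaw P m)
    (f := fun S => Real.exp (t * ∑ i, if E (S i) then (1 : ℝ) else 0))
    (ae_of_all _ fun S => (Real.exp_pos _).le) (Integrable.of_finite) (Real.exp (t * (m * q)))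
  simp only [Real.exp_le_exp] at hmarkov
  have h2 := hmarkov.trans hint
  rw [← le_div_iff₀' (Real.exp_pos _), ← Real.exp_sub] at h2
  refine h2.trans_eq ?_
  congr 1
  ring

/-- The square root of the empirical frequency of an event has Gaussian tails. -/
theorem sampleLaw_sqrt_deviation (P : PMF (V → A)) {m : ℕ} (hm : 0 < m) (E : (V → A) → Prop)
    [DecidablePred E] {δ : ℝ} (hδ : 0 < δ) :
    (sampleLaw P m).real {S | δ < |√(∑ x with E x, empirical S x) -
      √(∑ x with E x, massFunction P x)|} ≤ 2 * Real.exp (-(m * δ ^ 2)) := by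
  set p := ∑ x with E x, massFunction P x with hp
  have hp0 : 0 ≤ p := Finset.sum_nonneg fun x _ => massFunction_nonneg P x
  have hm' : (0 : ℝ) < m := by exact_mod_cast hm
  have hsq := Real.mul_self_sqrt hp0
  -- The choice `t = log (s / √p)` is half the optimal Poisson exponent `log (s² / p)`. With `log r
  -- ≥ 1 - 1 / r` it leaves exactly the square `-(s - √p)²`.
  have hrate : ∀ s : ℝ, 0 < √p → 0 < s →
      p * (Real.exp (Real.log (s / √p)) - 1) - Real.log (s / √p) * s ^ 2 ≤ -(s - √p) ^ 2 := by
    intro s hpp hs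
    have hr : 0 < s / √p := div_pos hs hpp
    rw [Real.exp_log hr]
    have hl := Real.one_sub_inv_le_log_of_pos hr
    have h3 : (1 - (s / √p)⁻¹) * s ^ 2 ≤ Real.log (s / √p) * s ^ 2 :=
      mul_le_mul_of_nonneg_right hl (sq_nonneg s)
    have h4 : (1 - (s / √p)⁻¹) * s ^ 2 = s ^ 2 - √p * s := by
      field_simp
    have h5 : p * (s / √p - 1) = √p * s - p := by
      linear_combination -(s / √p) * hsq + √p * div_mul_cancel₀ s hpp.ne'
    nlinarith
  have hupper : (sampleLaw P m).real {S | √p + δ < √(∑ x with E x, empirical S x)} ≤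
      Real.exp (-(m * δ ^ 2)) := by
    have hincl : ∀ t : ℝ, 0 ≤ t → {S : Fin m → V → A | √p + δ < √(∑ x with E x, empirical S x)} ⊆
        {S | t * (m * (√p + δ) ^ 2) ≤ t * ∑ i, if E (S i) then (1 : ℝ) else 0} := by
      intro t ht S hS
      refine mul_le_mul_of_nonneg_left ?_ ht
      simp only [Set.mem_ofPred_eq] at hS
      rw [sum_empirical_filter] at hS
      rw [← le_div_iff₀' hm']
      exact ((Real.lt_sqrt (by positivity)).1 hS).le
    -- For `p = 0` the ratio `s / √p` is meaningless, but `t = 1` already gives the exponent `-m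
    -- δ²`.
    rcases hp0.eq_or_lt with h0 | h0
    · refine (measureReal_mono (hincl 1 zero_le_one)).trans ((sampleLaw_chernoff P m E 1 _).trans ?_)
      rw [← hp, ← h0]
      refine Real.exp_le_exp.2 (le_of_eq ?_)
      simp
    · have hpp := Real.sqrt_pos.2 h0
      have hlog : 0 ≤ Real.log ((√p + δ) / √p) := Real.log_nonneg (by
        rw [le_div_iff₀ hpp]; linarith)
      refine (measureReal_mono (hincl _ hlog)).trans ((sampleLaw_chernoff P m E _ _).trans ?_)
      refine Real.exp_le_exp.2 ?_
      rw [← mul_neg]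
      refine mul_le_mul_of_nonneg_left ((hrate _ hpp (by positivity)).trans (le_of_eq ?_)) hm'.le
      ring
  have hlower : (sampleLaw P m).real {S | √(∑ x with E x, empirical S x) < √p - δ} ≤
      Real.exp (-(m * δ ^ 2)) := by
    rcases le_or_gt (√p - δ) 0 with h | h
    · have : {S : Fin m → V → A | √(∑ x with E x, empirical S x) < √p - δ} = ∅ := by
        ext S
        simp only [Set.mem_ofPred_eq, Set.mem_empty_iff_false, iff_false, not_lt]
        exact h.trans (Real.sqrt_nonneg _)
      rw [this, measureReal_empty]
      positivity
    · have hpp : 0 < √p := by linarith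
      have hlog : Real.log ((√p - δ) / √p) ≤ 0 := Real.log_nonpos (by positivity) (by
        rw [div_le_iff₀ hpp]; linarith)
      have hincl : {S : Fin m → V → A | √(∑ x with E x, empirical S x) < √p - δ} ⊆
          {S | Real.log ((√p - δ) / √p) * (m * (√p - δ) ^ 2) ≤
            Real.log ((√p - δ) / √p) * ∑ i, if E (S i) then (1 : ℝ) else 0} := by
        intro S hS
        refine mul_le_mul_of_nonpos_left ?_ hlog
        simp only [Set.mem_ofPred_eq] at hS
        rw [sum_empirical_filter] at hS
        rw [← div_le_iff₀' hm']
        exact ((Real.sqrt_lt' h).1 hS).le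
      refine (measureReal_mono hincl).trans ((sampleLaw_chernoff P m E _ _).trans ?_)
      refine Real.exp_le_exp.2 ?_
      rw [← mul_neg]
      refine mul_le_mul_of_nonneg_left ((hrate _ hpp h).trans (le_of_eq ?_)) hm'.le
      ring
  have hunion : {S : Fin m → V → A | δ < |√(∑ x with E x, empirical S x) - √p|} ⊆
      {S | √p + δ < √(∑ x with E x, empirical S x)} ∪
        {S | √(∑ x with E x, empirical S x) < √p - δ} := by
    intro S hS
    simp only [Set.mem_ofPred_eq, lt_abs] at hS
    rcases hS with hS | hS
    · left; simp only [Set.mem_ofPred_eq]; linarith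
    · right; simp only [Set.mem_ofPred_eq]; linarith
  refine (measureReal_mono hunion).trans ((measureReal_union_le _ _).trans ?_)
  linarith

/-- With high probability, the square roots of all two-variable marginals are accurate. -/
theorem sampleLaw_forall_marginalTwo (P : PMF (V → A)) {m : ℕ} (hm : 0 < m) {δ : ℝ} (hδ : 0 < δ) :
    1 - 2 * (Fintype.card V : ℝ) ^ 2 * (Fintype.card A : ℝ) ^ 2 * Real.exp (-(m * δ ^ 2)) ≤
      (sampleLaw P m).real {S | ∀ u v a b, |√(marginalTwo (empirical S) u v a b) -
        √(marginalTwo (massFunction P) u v a b)| ≤ δ} := by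
  set good := {S : Fin m → V → A | ∀ u v a b, |√(marginalTwo (empirical S) u v a b) -
        √(marginalTwo (massFunction P) u v a b)| ≤ δ} with hgood
  have hcompl : (sampleLaw P m).real goodᶜ ≤
      2 * (Fintype.card V : ℝ) ^ 2 * (Fintype.card A : ℝ) ^ 2 * Real.exp (-(m * δ ^ 2)) := by
    have hsub : goodᶜ ⊆ ⋃ i : V × V × A × A,
        {S | δ < |√(marginalTwo (empirical S) i.1 i.2.1 i.2.2.1 i.2.2.2) -
          √(marginalTwo (massFunction P) i.1 i.2.1 i.2.2.1 i.2.2.2)|} := by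
      intro S hS
      simp only [hgood, Set.mem_compl_iff, Set.mem_ofPred_eq, not_forall, not_le] at hS
      obtain ⟨u, v, a, b, h⟩ := hS
      exact Set.mem_iUnion.2 ⟨(u, v, a, b), h⟩
    refine (measureReal_mono hsub).trans ((measureReal_iUnion_fintype_le _).trans ?_)
    refine (Finset.sum_le_card_nsmul _ _ (2 * Real.exp (-(m * δ ^ 2))) fun i _ =>
      sampleLaw_sqrt_deviation P hm (fun y => y i.1 = i.2.2.1 ∧ y i.2.1 = i.2.2.2) hδ).trans
      (le_of_eq ?_)
    simp only [Finset.card_univ, Fintype.card_prod, nsmul_eq_mul]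
    push_cast
    ring
  have hc := probReal_compl_eq_one_sub (μ := sampleLaw P m) (s := good)
    (Set.Finite.measurableSet (Set.toFinite _))
  linarith

end Concentration

end ChowLiu

namespace ChowLiu

/-! ### Independence of the components of the skeleton -/

section Skeleton

variable {V : Type*} {G : Digraph V}

theorem reachable_of_adj {a b : V} (h : G.Adj a b) : (skel G).Reachable a b := by
  rcases eq_or_ne a b with rfl | hne
  · exact SimpleGraph.Reachable.refl _
  · exact SimpleGraph.Adj.reachable ((SimpleGraph.fromRel_adj _ _ _).2 ⟨hne, Or.inl h⟩)

theorem mem_component_iff_of_adj (r : V) (a b : V) (h : G.Adj a b) :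
    a ∈ {w | (skel G).Reachable r w} ↔ b ∈ {w | (skel G).Reachable r w} :=
  ⟨fun ha => SimpleGraph.Reachable.trans ha (reachable_of_adj h),
    fun hb => SimpleGraph.Reachable.trans hb (reachable_of_adj h).symm⟩

end Skeleton

section Independence

variable {V A : Type*} [Fintype V] [DecidableEq V] [Fintype A] [DecidableEq A]

open Classical in
/-- Exchanging the coordinates in `K` of two independent copies. -/
theorem sum_mul_sum_of_dependsOn {V A : Type*} [Fintype V] [DecidableEq V] [Fintype A] {K : Set V} {f g φ ψ : (V → A) → ℝ} (hf : DependsOn f K)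
    (hg : DependsOn g Kᶜ) (hφ : DependsOn φ K) (hψ : DependsOn ψ Kᶜ) :
    (∑ y, φ y * ψ y * (f y * g y)) * ∑ z, f z * g z =
      (∑ y, φ y * (f y * g y)) * ∑ z, ψ z * (f z * g z) := by
  have hK : ∀ (h : (V → A) → ℝ), DependsOn h K → ∀ y z, h (K.piecewise y z) = h y :=
    fun h hh y z => hh fun i hi => Set.piecewise_eq_of_mem _ _ _ hi
  have hKc : ∀ (h : (V → A) → ℝ), DependsOn h Kᶜ → ∀ y z, h (K.piecewise y z) = h z :=
    fun h hh y z => hh fun i hi => Set.piecewise_eq_of_notMem _ _ _ hi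
  rw [Finset.sum_mul_sum, Finset.sum_mul_sum, ← Finset.sum_product', ← Finset.sum_product']
  -- Swapping the coordinates outside `K` between two copies is an involution on pairs that matches
  -- the two double sums term by term.
  have hinv : ∀ y z : V → A, K.piecewise (K.piecewise y z) (K.piecewise z y) = y := by
    intro y z
    ext i
    by_cases hi : i ∈ K <;> simp [hi]
  refine Finset.sum_nbij' (fun w => (K.piecewise w.1 w.2, K.piecewise w.2 w.1))
    (fun w => (K.piecewise w.1 w.2, K.piecewise w.2 w.1)) (fun _ _ => by simp) (fun _ _ => by simp)
    (fun w _ => by simp [hinv]) (fun w _ => by simp [hinv]) fun w _ => ?_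
  simp only [hK f hf, hK φ hφ, hKc g hg, hKc ψ hψ]
  ring

theorem dependsOn_marginal (p : (V → A) → ℝ) (s : Finset V) : DependsOn (marginal p s) s := by
  intro x y h
  simp only [marginal]
  refine Finset.sum_congr (Finset.filter_congr fun z _ => ?_) fun _ _ => rfl
  exact forall₂_congr fun v hv => by rw [h v hv]

theorem dependsOn_prod {V A : Type*} {K : Set V} {ι : Type*} (s : Finset ι) {F : ι → (V → A) → ℝ}
    (h : ∀ i ∈ s, DependsOn (F i) K) : DependsOn (fun x => ∏ i ∈ s, F i x) K := fun _ _ hxy =>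
  Finset.prod_congr rfl fun i hi => h i hi hxy

theorem mem_parents {V : Type*} [Fintype V] {G : Digraph V} {u v : V} : u ∈ parents G v ↔ G.Adj u v := by
  simp [parents]

variable {P : PMF (V → A)} {G : Digraph V}

open Classical in
/-- The variables in a set that no edge leaves or enters are independent of the others. -/
theorem IsMarkov.sum_mul_eq (hP : IsMarkov P G) {K : Set V}
    (hK : ∀ a b, G.Adj a b → (a ∈ K ↔ b ∈ K)) {φ ψ : (V → A) → ℝ} (hφ : DependsOn φ K)
    (hψ : DependsOn ψ Kᶜ) :
    ∑ y, φ y * ψ y * massFunction P y =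
      (∑ y, φ y * massFunction P y) * ∑ y, ψ y * massFunction P y := by
  set F : V → (V → A) → ℝ := fun v x => marginal (massFunction P) (insert v (parents G v)) x /
    marginal (massFunction P) (parents G v) x with hF
  have hFdep : ∀ (v : V) (L : Set V), v ∈ L → (∀ u, G.Adj u v → u ∈ L) → DependsOn (F v) L := by
    intro v L hv hL x y hxy
    simp only [hF]
    rw [dependsOn_marginal (massFunction P) (insert v (parents G v)) fun i hi => hxy i ?_,
      dependsOn_marginal (massFunction P) (parents G v) fun i hi => hxy i ?_]
    · exact hL i (mem_parents.1 hi)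
    · rcases Finset.mem_insert.1 hi with rfl | hi
      · exact hv
      · exact hL i (mem_parents.1 hi)
  -- A vertex and its parents lie on the same side of `K`, so the mass splits into a function of the
  -- coordinates in `K` and one of the others.
  have hfac : ∀ x, massFunction P x = (∏ v with v ∈ K, F v x) * ∏ v with v ∉ K, F v x := by
    intro x
    rw [hP x, Finset.prod_filter_mul_prod_filter_not]
  have h := sum_mul_sum_of_dependsOn (K := K) (f := fun x => ∏ v with v ∈ K, F v x)
    (g := fun x => ∏ v with v ∉ K, F v x) (φ := φ) (ψ := ψ)
    (dependsOn_prod _ fun v hv => hFdep v K (Finset.mem_filter.1 hv).2 fun u hu =>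
      (hK u v hu).2 (Finset.mem_filter.1 hv).2)
    (dependsOn_prod _ fun v hv => hFdep v Kᶜ (Finset.mem_filter.1 hv).2 fun u hu huK =>
      (Finset.mem_filter.1 hv).2 ((hK u v hu).1 huK)) hφ hψ
  simp only [← hfac, sum_massFunction, mul_one] at h
  exact h

theorem IsMarkov.sum_filter_and (hP : IsMarkov P G) {K : Set V}
    (hK : ∀ a b, G.Adj a b → (a ∈ K ↔ b ∈ K)) {B C : (V → A) → Prop}
    [DecidablePred B] [DecidablePred C] (hB : DependsOn B K) (hC : DependsOn C Kᶜ) :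
    ∑ y with B y ∧ C y, massFunction P y =
      (∑ y with B y, massFunction P y) * ∑ y with C y, massFunction P y := by
  have h := hP.sum_mul_eq hK (φ := fun y => if B y then 1 else 0)
    (ψ := fun y => if C y then 1 else 0) (fun x y hxy => by simp only [hB hxy])
    (fun x y hxy => by simp only [hC hxy])
  simp only [Finset.sum_filter]
  simpa only [ite_mul, one_mul, zero_mul, mul_ite, mul_one, mul_zero, ← ite_and, and_comm] using h

theorem IsMarkov.marginal_union (hP : IsMarkov P G) {K : Set V}
    (hK : ∀ a b, G.Adj a b → (a ∈ K ↔ b ∈ K)) {s t : Finset V} (hs : ∀ v ∈ s, v ∈ K)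
    (ht : ∀ v ∈ t, v ∉ K) (x : V → A) :
    marginal (massFunction P) (s ∪ t) x =
      marginal (massFunction P) s x * marginal (massFunction P) t x := by
  have h := hP.sum_filter_and hK (B := fun y => ∀ v ∈ s, y v = x v)
    (C := fun y => ∀ v ∈ t, y v = x v)
    (fun y z hyz => propext (forall₂_congr fun v hv => by rw [hyz v (hs v hv)]))
    (fun y z hyz => propext (forall₂_congr fun v hv => by rw [hyz v (ht v hv)]))
  simp only [marginal]
  convert h using 2
  refine Finset.filter_congr fun y _ => ?_
  simp only [Finset.mem_union, or_imp, forall_and]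

/-- Variables in different components of the skeleton have no mutual information. -/
theorem IsMarkov.mutualInfo_eq_zero (hP : IsMarkov P G) {u v : V}
    (h : ¬ (skel G).Reachable u v) : mutualInfo (massFunction P) u v = 0 := by
  refine Finset.sum_eq_zero fun a _ => Finset.sum_eq_zero fun b _ => ?_
  have h2 : marginalTwo (massFunction P) u v a b =
      marginalOne (massFunction P) u a * marginalOne (massFunction P) v b := by
    exact hP.sum_filter_and (mem_component_iff_of_adj u) (B := fun y => y u = a)
      (C := fun y => y v = b)
      (fun y z hyz => by simp only [hyz u (SimpleGraph.Reachable.refl _)])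
      (fun y z hyz => by simp only [hyz v h])
  rw [h2]
  rcases eq_or_ne (marginalOne (massFunction P) u a * marginalOne (massFunction P) v b) 0 with h0 | h0
  · rw [h0, zero_mul]
  · rw [div_self h0, Real.log_one, mul_zero]

/-- Edges between different components of the skeleton may be added to the directed graph. -/
theorem IsMarkov.of_le (hP : IsMarkov P G) {G' : Digraph V} (hle : ∀ a b, G.Adj a b → G'.Adj a b)
    (hnew : ∀ a b, G'.Adj a b → G.Adj a b ∨ ¬ (skel G).Reachable a b) : IsMarkov P G' := by
  intro x
  -- The new parents of `v` lie outside its component, so their marginal factors out of numerator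
  -- and denominator alike.
  set E : V → Finset V := fun v => parents G' v \ parents G v
  have hpar : ∀ v, parents G' v = parents G v ∪ E v := fun v =>
    (Finset.union_sdiff_of_subset fun u hu => mem_parents.2 (hle _ _ (mem_parents.1 hu))).symm
  have hE : ∀ v, ∀ u ∈ E v, u ∉ {w | (skel G).Reachable v w} := by
    intro v u hu hr
    rw [Finset.mem_sdiff, mem_parents, mem_parents] at hu
    exact ((hnew u v hu.1).resolve_left hu.2) (SimpleGraph.Reachable.symm hr)
  have hmem : ∀ v, ∀ u ∈ parents G v, u ∈ {w | (skel G).Reachable v w} := fun v u hu =>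
    (reachable_of_adj (mem_parents.1 hu)).symm
  have hins : ∀ v, ∀ u ∈ insert v (parents G v), u ∈ {w | (skel G).Reachable v w} := by
    intro v u hu
    rcases Finset.mem_insert.1 hu with rfl | hu
    · exact SimpleGraph.Reachable.refl _
    · exact hmem v u hu
  have hfactor : ∀ v, marginal (massFunction P) (insert v (parents G' v)) x /
      marginal (massFunction P) (parents G' v) x =
      marginal (massFunction P) (insert v (parents G v)) x * marginal (massFunction P) (E v) x /
      (marginal (massFunction P) (parents G v) x * marginal (massFunction P) (E v) x) := by
    intro v
    rw [hpar v, ← Finset.insert_union,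
      hP.marginal_union (mem_component_iff_of_adj v) (hins v) (hE v),
      hP.marginal_union (mem_component_iff_of_adj v) (hmem v) (hE v)]
  simp only [hfactor]
  -- If such a marginal vanishes it cannot be cancelled, but it dominates `P(x)`, so both sides are
  -- `0`.
  by_cases h0 : ∃ v, marginal (massFunction P) (E v) x = 0
  · obtain ⟨v, hv⟩ := h0
    rw [Finset.prod_eq_zero (Finset.mem_univ v) (by rw [hv, mul_zero, zero_div])]
    refine le_antisymm ?_ (massFunction_nonneg P x)
    rw [← hv]
    exact Finset.single_le_sum (f := massFunction P) (fun y _ => massFunction_nonneg P y)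
      (by simp)
  · rw [hP x]
    refine Finset.prod_congr rfl fun v _ => ?_
    rw [mul_div_mul_right _ _ fun h => h0 ⟨v, h⟩]

end Independence

end ChowLiu

namespace ChowLiu

/-! ### Edge exchange and orientation of trees -/

section Graph

variable {V : Type*}

theorem edgeSet_sup_edge_deleteEdges (T : SimpleGraph V) {a b : V} (hab : a ≠ b) (e : Sym2 V) :
    ((T ⊔ SimpleGraph.edge a b).deleteEdges {e}).edgeSet = insert s(a, b) T.edgeSet \ {e} := by
  have h : Disjoint {s(a, b)} (Sym2.diagSet : Set (Sym2 V)) :=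
    Set.disjoint_singleton_left.2 (by simpa using hab)
  rw [SimpleGraph.edgeSet_deleteEdges, SimpleGraph.edgeSet_sup, SimpleGraph.edge,
    SimpleGraph.edgeSet_fromEdgeSet, h.sdiff_eq_left, Set.union_comm, Set.singleton_union]

/-- Exchanging an edge of a spanning tree that crosses a cut for another one that does. -/
theorem exists_isTree_exchange [Fintype V] {T : SimpleGraph V} (hT : T.IsTree) {a b : V}
    (hab : a ≠ b) (hnT : ¬ T.Adj a b) {K : Set V} (ha : a ∈ K) (hb : b ∉ K) :
    ∃ x y, T.Adj x y ∧ x ∈ K ∧ y ∉ K ∧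
      ((T ⊔ SimpleGraph.edge a b).deleteEdges {s(x, y)}).IsTree := by
  classical
  obtain ⟨p, hp⟩ := (hT.connected.preconnected b a).exists_isPath
  obtain ⟨d, hd, hdK, hdK'⟩ := p.exists_boundary_dart Kᶜ hb (fun h => h ha)
  have hadj : T.Adj d.snd d.fst := d.adj.symm
  refine ⟨d.snd, d.fst, hadj, not_not.1 hdK', hdK, ?_⟩
  have hmem : s(d.snd, d.fst) ∈ p.edges := by
    rw [Sym2.eq_swap]
    exact List.mem_map.2 ⟨d, hd, rfl⟩
  set T₂ := T ⊔ SimpleGraph.edge a b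
  have hle : T ≤ T₂ := le_sup_left
  have habT : T₂.Adj a b := Or.inr ((SimpleGraph.edge_adj _ _ _ _).2 ⟨Or.inl ⟨rfl, rfl⟩, hab⟩)
  -- The new edge closes the tree path to a cycle through the crossing edge, whose removal thus
  -- preserves connectedness; the edge count is that of `T`.
  have hcyc : (SimpleGraph.Walk.cons habT (p.mapLe hle)).IsCycle := by
    refine SimpleGraph.Path.cons_isCycle ⟨p.mapLe hle, hp.mapLe hle⟩ habT fun h => hnT ?_
    rw [SimpleGraph.Walk.edges_mapLe_eq_edges] at h
    exact p.adj_of_mem_edges h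
  have hconn := (hT.connected.mono hle).connected_delete_edge_of_not_isBridge
    (x := d.snd) (y := d.fst) fun hbr => hbr.notMem_edges_of_isCycle hcyc (by
      rw [SimpleGraph.Walk.edges_cons, SimpleGraph.Walk.edges_mapLe_eq_edges]
      exact List.mem_cons_of_mem _ hmem)
  refine SimpleGraph.isTree_iff_connected_and_card.2 ⟨hconn, ?_⟩
  rw [← (SimpleGraph.isTree_iff_connected_and_card.1 hT).2]
  congr 1
  rw [Nat.card_coe_set_eq, Nat.card_coe_set_eq, edgeSet_sup_edge_deleteEdges T hab,
    Set.ncard_sdiff_singleton_of_mem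
      (Set.mem_insert_of_mem _ ((SimpleGraph.mem_edgeSet T).2 hadj)), Set.ncard_insert_of_notMem
      (mt (SimpleGraph.mem_edgeSet T).1 hnT)]
  rfl

/-- Any tree that extends the skeleton is the skeleton of a polytree obtained by adding edges
between different components. -/
theorem exists_isPolytree_skel_eq {G : Digraph V} (hG : IsPolytree G) {T : SimpleGraph V}
    (hT : T.IsAcyclic) (hle : skel G ≤ T)
    (hnew : ∀ u v, T.Adj u v → ¬ (skel G).Adj u v → ¬ (skel G).Reachable u v) :
    ∃ G' : Digraph V, IsPolytree G' ∧ skel G' = T ∧ (∀ a b, G.Adj a b → G'.Adj a b) ∧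
      ∀ a b, G'.Adj a b → G.Adj a b ∨ ¬ (skel G).Reachable a b := by
  -- Acyclicity of `G` makes directed reachability antisymmetric, so it extends to a linear order,
  -- along which the new edges are oriented.
  have hpo : IsPartialOrder V (Relation.ReflTransGen G.Adj) :=
    { refl := fun _ => Relation.ReflTransGen.refl
      trans := fun _ _ _ => Relation.ReflTransGen.trans
      antisymm := fun u v huv hvu => by
        rcases Relation.reflTransGen_iff_eq_or_transGen.1 huv with h | h
        · exact h.symm
        · exact absurd (h.trans_left hvu) (hG.1 u) }
  obtain ⟨s, hs, hrs⟩ := extend_partialOrder (Relation.ReflTransGen G.Adj)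
  have hne : ∀ {u v}, G.Adj u v → u ≠ v := by
    rintro u _ h rfl
    exact hG.1 u (Relation.TransGen.single h)
  let G' : Digraph V :=
    { Adj := fun u v => G.Adj u v ∨ (T.Adj u v ∧ ¬ (skel G).Reachable u v ∧ s u v) }
  have hord : ∀ u v, G'.Adj u v → s u v ∧ u ≠ v := by
    rintro u v (h | h)
    · exact ⟨hrs _ _ (Relation.ReflTransGen.single h), hne h⟩
    · exact ⟨h.2.2, h.1.ne⟩
  have htrans : ∀ u v, Relation.TransGen G'.Adj u v → s u v ∧ u ≠ v := by
    intro u v h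
    induction h with
    | single h => exact hord _ _ h
    | tail _ h ih =>
      obtain ⟨h1, h2⟩ := hord _ _ h
      refine ⟨_root_.trans ih.1 h1, ?_⟩
      rintro rfl
      exact h2 (antisymm h1 ih.1)
  have hskel : skel G' = T := by
    ext u v
    refine (SimpleGraph.fromRel_adj _ _ _).trans ⟨?_, fun h => ⟨h.ne, ?_⟩⟩
    · rintro ⟨huv, (h | h) | (h | h)⟩
      · exact hle ((SimpleGraph.fromRel_adj _ _ _).2 ⟨huv, Or.inl h⟩)
      · exact h.1
      · exact hle ((SimpleGraph.fromRel_adj _ _ _).2 ⟨huv, Or.inr h⟩)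
      · exact h.1.symm
    · by_cases hadj : (skel G).Adj u v
      · exact ((SimpleGraph.fromRel_adj _ _ _).1 hadj).2.imp Or.inl Or.inl
      · have hr := hnew u v h hadj
        exact (total_of s u v).imp (fun hs => Or.inr ⟨h, hr, hs⟩)
          fun hs => Or.inr ⟨h.symm, fun h' => hr h'.symm, hs⟩
  exact ⟨G', ⟨fun v h => (htrans v v h).2 rfl, hskel ▸ hT⟩, hskel, fun a b h => Or.inl h,
    fun a b h => h.imp id fun h => h.2.1⟩

end Graph

/-! ### Recovery from accurate weights -/

section Recovery

variable {V A : Type*} [Fintype V] [DecidableEq V] [Fintype A] [DecidableEq A]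

theorem totalWeight_exchange (p : (V → A) → ℝ) {T : SimpleGraph V} {a b x y : V} (hab : a ≠ b)
    (hnT : ¬ T.Adj a b) (hxy : T.Adj x y) :
    totalWeight p ((T ⊔ SimpleGraph.edge a b).deleteEdges {s(x, y)}) + mutualInfo p x y =
      totalWeight p T + mutualInfo p a b := by
  classical
  have hset : ((T ⊔ SimpleGraph.edge a b).deleteEdges {s(x, y)}).edgeFinset =
      (insert s(a, b) T.edgeFinset).erase s(x, y) := by
    ext e
    simp only [SimpleGraph.mem_edgeFinset, edgeSet_sup_edge_deleteEdges T hab, Finset.mem_erase,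
      Finset.mem_insert, Set.mem_sdiff, Set.mem_insert_iff, Set.mem_singleton_iff]
    tauto
  have h1 := Finset.sum_erase_add (insert s(a, b) T.edgeFinset)
    (Sym2.lift ⟨mutualInfo p, mutualInfo_comm p⟩) (a := s(x, y))
    (Finset.mem_insert_of_mem (SimpleGraph.mem_edgeFinset.2 hxy))
  have h2 := Finset.sum_insert (s := T.edgeFinset) (a := s(a, b))
    (f := Sym2.lift ⟨mutualInfo p, mutualInfo_comm p⟩) fun h => hnT (SimpleGraph.mem_edgeFinset.1 h)
  rw [h2, ← hset] at h1
  simp only [Sym2.lift_mk] at h1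
  unfold totalWeight
  convert h1.trans (add_comm _ _)

variable {P : PMF (V → A)} {G : Digraph V} {ε : ℝ} {q : (V → A) → ℝ} {T : SimpleGraph V}

/-- A maximum-weight spanning tree for sufficiently accurate weights contains the skeleton. -/
theorem IsChowLiuTree.skel_le (hT : IsChowLiuTree q T) (hG : IsPolytree G) (hP : IsMarkov P G)
    (hgap : GapAssumption P G ε)
    (hq : ∀ u v, |mutualInfo q u v - mutualInfo (massFunction P) u v| < ε / 2) : skel G ≤ T := by
  intro a b hab
  by_contra hnT
  have hbr : ¬ ((skel G).deleteEdges {s(a, b)}).Reachable a b :=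
    SimpleGraph.isBridge_iff.1 (SimpleGraph.isAcyclic_iff_forall_adj_isBridge.1 hG.2 hab)
  obtain ⟨x, y, hxy, hx, hy, htree⟩ := exists_isTree_exchange hT.1 hab.ne hnT
    (K := {w | ((skel G).deleteEdges {s(a, b)}).Reachable a w})
    (SimpleGraph.Reachable.refl _) hbr
  have hle : mutualInfo (massFunction P) x y + ε ≤ mutualInfo (massFunction P) a b := by
    by_cases hr : (skel G).Reachable x y
    · obtain ⟨w, hw⟩ := hr.exists_isPath
      have hmem : s(a, b) ∈ w.edges := by
        by_contra hmem
        exact hy (SimpleGraph.Reachable.trans hx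
          (SimpleGraph.reachable_deleteEdges_iff_exists_walk.2 ⟨w, hmem⟩))
      refine hgap.1 x y w hw ?_ a b hmem
      -- A path of length one through `ab` would make `xy` the edge `ab`, but `T` contains the first
      -- and not the second.
      by_contra! hlen
      cases w with
      | nil => simp at hmem
      | cons h w' =>
        cases w' with
        | nil =>
          simp only [SimpleGraph.Walk.edges_cons, SimpleGraph.Walk.edges_nil,
            List.mem_singleton] at hmem
          exact hnT ((SimpleGraph.mem_edgeSet T).1 (hmem ▸ hxy))
        | cons h' w'' =>
          simp only [SimpleGraph.Walk.length_cons] at hlen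
          omega
    · rw [hP.mutualInfo_eq_zero hr, zero_add]
      exact hgap.2 a b hab
  have h1 := totalWeight_exchange q hab.ne hnT hxy
  have h2 := hT.2 _ htree
  have h3 := abs_lt.1 (hq x y)
  have h4 := abs_lt.1 (hq a b)
  linarith

/-- A maximum-weight spanning tree for sufficiently accurate weights recovers a ground truth
skeleton. -/
theorem IsChowLiuTree.recovers (hT : IsChowLiuTree q T) (hG : IsPolytree G) (hP : IsMarkov P G)
    (hgap : GapAssumption P G ε)
    (hq : ∀ u v, |mutualInfo q u v - mutualInfo (massFunction P) u v| < ε / 2) :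
    (∃ G' : Digraph V, IsPolytree G' ∧ IsMarkov P G' ∧ skel G' = T) ∧ skel G ≤ T ∧
      (∀ u v, T.Adj u v → ¬ (skel G).Adj u v → ¬ (skel G).Reachable u v ∧
        ∀ a b, (skel G).Adj a b → mutualInfo q u v < mutualInfo q a b) ∧
      ((skel G).Connected → T = skel G) := by
  have hle := hT.skel_le hG hP hgap hq
  have hnew : ∀ u v, T.Adj u v → ¬ (skel G).Adj u v → ¬ (skel G).Reachable u v := by
    intro u v huv hn hr
    obtain ⟨w, hw⟩ := hr.exists_isPath
    -- Paths in `T` are unique, so a skeleton path from `u` to `v` would be the edge `uv` itself.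
    have huniq := (hT.1.isAcyclic.subsingleton_path u v).elim ⟨w.mapLe hle, hw.mapLe hle⟩
      (SimpleGraph.Path.singleton huv)
    have hedges : w.edges = [s(u, v)] := by
      rw [← SimpleGraph.Walk.edges_mapLe_eq_edges hle]
      exact congrArg (fun p : T.Path u v => (p : T.Walk u v).edges) huniq
    exact hn (w.adj_of_mem_edges (by simp [hedges]))
  obtain ⟨G', hG', hskel, hext, hcross⟩ :=
    exists_isPolytree_skel_eq hG hT.1.isAcyclic hle hnew
  refine ⟨⟨G', hG', hP.of_le hext hcross, hskel⟩, hle, fun u v huv hn =>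
    ⟨hnew u v huv hn, fun a b hab => ?_⟩, fun hconn => le_antisymm (fun u v huv => ?_) hle⟩
  -- The true information of `u` and `v` is `0`, so `ε / 2` separates the two empirical weights.
  · have h1 := abs_lt.1 (hq u v)
    have h2 := abs_lt.1 (hq a b)
    have h3 := hgap.2 a b hab
    have h4 := hP.mutualInfo_eq_zero (hnew u v huv hn)
    linarith
  · by_contra hn
    exact hnew u v huv hn (hconn.preconnected u v)

end Recovery

end ChowLiu

/-! ### Choice of constants -/

namespace ChowLiu

/-- In the exponent, `2` absorbs the factor `n²` and `2 k²` absorbs the constant, since `2 k² ≤ 2 ^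
(2 k²) ≤ n ^ (2 k²)`. -/
theorem union_bound_le_rpow {n : ℕ} (hn : 2 ≤ n) (k : ℕ) {c r : ℝ}
    (hr : (c + 2 + 2 * (k : ℝ) ^ 2) * Real.log n ≤ r) :
    2 * (n : ℝ) ^ 2 * (k : ℝ) ^ 2 * Real.exp (-r) ≤ (n : ℝ) ^ (-c) := by
  have hn0 : (0 : ℝ) < n := by positivity
  have hpow : 2 * (k : ℝ) ^ 2 ≤ (n : ℝ) ^ (2 * (k : ℝ) ^ 2) := by
    have h1 : 2 * k ^ 2 ≤ n ^ (2 * k ^ 2) :=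
      (Nat.lt_two_pow_self (n := 2 * k ^ 2)).le.trans (Nat.pow_le_pow_left hn _)
    have h2 : ((2 * k ^ 2 : ℕ) : ℝ) ≤ ((n ^ (2 * k ^ 2) : ℕ) : ℝ) := Nat.cast_le.2 h1
    have h3 : (n : ℝ) ^ (2 * (k : ℝ) ^ 2) = ((n ^ (2 * k ^ 2) : ℕ) : ℝ) := by
      rw [show 2 * (k : ℝ) ^ 2 = ((2 * k ^ 2 : ℕ) : ℝ) by push_cast; rfl, Real.rpow_natCast,
        Nat.cast_pow]
    rw [h3]
    exact_mod_cast h2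
  have hexp : Real.exp (-r) ≤ (n : ℝ) ^ (-(c + 2 + 2 * (k : ℝ) ^ 2)) := by
    rw [Real.rpow_def_of_pos hn0]
    refine Real.exp_le_exp.2 ?_
    linarith
  calc 2 * (n : ℝ) ^ 2 * (k : ℝ) ^ 2 * Real.exp (-r)
      = 2 * (k : ℝ) ^ 2 * ((n : ℝ) ^ 2 * Real.exp (-r)) := by ring
    _ ≤ (n : ℝ) ^ (2 * (k : ℝ) ^ 2) *
        ((n : ℝ) ^ 2 * (n : ℝ) ^ (-(c + 2 + 2 * (k : ℝ) ^ 2))) := by gcongr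
    _ = (n : ℝ) ^ (-c) := by
        rw [← Real.rpow_two (n : ℝ), ← Real.rpow_add hn0, ← Real.rpow_add hn0]
        congr 1
        ring

end ChowLiu

theorem mainTheorem6 (k : ℕ) (c : ℝ) (hc : 0 < c) :
    ∃ C : ℝ, 0 < C ∧
      ∀ (n : ℕ) (P : PMF (Fin n → Fin k)) (G : Digraph (Fin n)) (ε : ℝ) (m : ℕ),
        1 ≤ n → ChowLiu.IsPolytree G → ChowLiu.IsMarkov P G →
        0 < ε → ChowLiu.GapAssumption P G ε →
        C * (Real.log n / ε ^ 2) ≤ m →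
        1 - (n : ℝ) ^ (-c) ≤ (ChowLiu.sampleLaw P m).real
          {S | ∀ T : SimpleGraph (Fin n), ChowLiu.IsChowLiuTree (ChowLiu.empirical S) T →
            (∃ G' : Digraph (Fin n), ChowLiu.IsPolytree G' ∧ ChowLiu.IsMarkov P G' ∧
              ChowLiu.skel G' = T) ∧
            ChowLiu.skel G ≤ T ∧
            (∀ u v, T.Adj u v → ¬ (ChowLiu.skel G).Adj u v →
              ¬ (ChowLiu.skel G).Reachable u v ∧
              ∀ a b, (ChowLiu.skel G).Adj a b →
                ChowLiu.mutualInfo (ChowLiu.empirical S) u v <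
                  ChowLiu.mutualInfo (ChowLiu.empirical S) a b) ∧
            ((ChowLiu.skel G).Connected → T = ChowLiu.skel G)} := by
  -- The factor `81 (k + 1)⁴` is `(ε / δ)²` for the `δ` chosen below.
  refine ⟨81 * ((k : ℝ) + 1) ^ 4 * (c + 2 + 2 * (k : ℝ) ^ 2), by positivity, ?_⟩
  intro n P G ε m hn hG hP hε hgap hm
  -- For `n = 1` the sample may be empty, but the claimed probability is `0`.
  rcases hn.eq_or_lt with rfl | hn2
  · simp only [Nat.cast_one, Real.one_rpow, sub_self]
    exact measureReal_nonneg
  have hn2' : (1 : ℝ) < n := by exact_mod_cast hn2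
  have hlog : 0 < Real.log n := Real.log_pos hn2'
  have hm0 : 0 < m := by
    have : (0 : ℝ) < m := lt_of_lt_of_le (by positivity) hm
    exact_mod_cast this
  set δ : ℝ := ε / (9 * ((k : ℝ) + 1) ^ 2) with hδ
  have hδ0 : 0 < δ := by positivity
  have hrate : (c + 2 + 2 * (k : ℝ) ^ 2) * Real.log n ≤ m * δ ^ 2 := by
    refine le_trans (le_of_eq ?_) (mul_le_mul_of_nonneg_right hm (sq_nonneg δ))
    rw [hδ]
    field_simp
    norm_num
  have hgood := ChowLiu.sampleLaw_forall_marginalTwo P hm0 hδ0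
  have hbad := ChowLiu.union_bound_le_rpow hn2 k hrate
  simp only [Fintype.card_fin] at hgood
  refine (by linarith : 1 - (n : ℝ) ^ (-c) ≤ _).trans (hgood.trans (measureReal_mono ?_))
  intro S hS T hT
  refine hT.recovers hG hP hgap fun u v => ?_
  refine (ChowLiu.abs_mutualInfo_sub_le (ChowLiu.empirical_nonneg S)
    (ChowLiu.sum_empirical_le_one S) (ChowLiu.massFunction_nonneg P)
    (ChowLiu.sum_massFunction P).le hS u v).trans_lt ?_
  -- Since `2 k + k² < (k + 1)²`, the error is below `4 ε / 9 < ε / 2`.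
  rw [Fintype.card_fin, hδ, mul_div_assoc', div_mul_eq_mul_div,
    div_lt_div_iff₀ (by positivity) two_pos]
  nlinarith [mul_pos hε (by positivity : (0 : ℝ) < ((k : ℝ) + 1) ^ 2)]
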